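/- Let $d\ge 1$ be an integer, let $\mathbb B_d\subset\mathbb C^d$ be the open Euclidean unit ball and $\mathbb D\subset\mathbb C$ the open unit disc. Let $H^2_d$ be the Drury--Arveson space, that is, the reproducing kernel Hilbert space on $\mathbb B_d$ with kernel $\frac{1}{1-\langle z,w\rangle}$, where $\langle z,w\rangle=\sum_{i=1}^d z_i\overline{w_i}$. Let $$\tau:\mathbb B_d\to\mathbb D,\qquad \tau(z)=d^{d/2}z_1z_2\cdots z_d,$$ let $a_n=\|\tau^n\|_{H^2_d}^{-2}$ for $n\ge 0$, and let $\mathcal H_d$ be the reproducing kernel Hilbert space on $\mathbb D$ with kernel $K(z,w)=\sum_{n=0}^\infty a_n(z\overline w)^n$. For a reproducing kernel Hilbert space $\mathcal H$ of functions on a set $X$, let $\mathrm{Mult}(\mathcal H)$ be the algebra of all functions $\varphi:X\to\mathbb C$ with $\varphi f\in\mathcal H$ for all $f\in\mathcal H$; for $r\ge 1$, a matrix $[\varphi_{ij}]\in M_r(\mathrm{Mult}(\mathcal H))$ is given the norm of the operator $(f_j)_j\mapsto(\sum_j\varphi_{ij}f_j)_i$ on the Hilbert space direct sum $\mathcal H^r$.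 Then $\varphi\circ\tau\in\mathrm{Mult}(H^2_d)$ for every $\varphi\in\mathrm{Mult}(\mathcal H_d)$, and the linear map $$\Phi:\mathrm{Mult}(\mathcal H_d)\to\mathrm{Mult}(H^2_d),\qquad \varphi\mapsto\varphi\circ\tau,$$ is a unital complete isometry: $\Phi(1)=1$, and for every $r\ge 1$ and every $[\varphi_{ij}]\in M_r(\mathrm{Mult}(\mathcal H_d))$, $$\big\|[\varphi_{ij}\circ\tau]\big\|_{M_r(\mathrm{Mult}(H^2_d))}=\big\|[\varphi_{ij}]\big\|_{M_r(\mathrm{Mult}(\mathcal H_d))}.$$ -/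

import Mathlib

noncomputable section

namespace MultEmbed

open scoped ComplexConjugate

/-! ### Multiplier algebras of scalar reproducing kernel Hilbert spaces -/

section Multipliers

variable {X : Type*} (H : Type*) [NormedAddCommGroup H] [InnerProductSpace ℂ H]
  [RKHS ℂ H X ℂ]

/-- The multiplier algebra of a space `H` of functions on `X`: all functions `φ` such that
`φ * f` belongs to `H` for every `f` in `H`. -/
def Mult : Subalgebra ℂ (X → ℂ) where
  carrier := {φ | ∀ f : H, ∃ g : H, (g : X → ℂ) = φ * f}
  mul_mem' := by
    intro φ ψ hφ hψ f
    obtain ⟨g, hg⟩ := hψ f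
    obtain ⟨h, hh⟩ := hφ g
    exact ⟨h, by rw [hh, hg, mul_assoc]⟩
  add_mem' := by
    intro φ ψ hφ hψ f
    obtain ⟨g, hg⟩ := hφ f
    obtain ⟨h, hh⟩ := hψ f
    exact ⟨g + h, by rw [RKHS.coe_add, hg, hh, add_mul]⟩
  algebraMap_mem' := by
    intro c f
    refine ⟨c • f, ?_⟩
    rw [RKHS.coe_smul, Algebra.algebraMap_eq_smul_one, smul_mul_assoc, one_mul]

variable {H}

/-- The multiplication operator `f ↦ φ * f` as a linear map. -/
def mulLin (φ : Mult H) : H →ₗ[ℂ] H where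
  toFun f := (φ.2 f).choose
  map_add' f g := by
    apply DFunLike.coe_injective
    refine (φ.2 (f + g)).choose_spec.trans ?_
    rw [RKHS.coe_add, RKHS.coe_add, mul_add]
    exact congrArg₂ (· + ·) (φ.2 f).choose_spec.symm (φ.2 g).choose_spec.symm
  map_smul' c f := by
    apply DFunLike.coe_injective
    refine (φ.2 (c • f)).choose_spec.trans ?_
    rw [RingHom.id_apply, RKHS.coe_smul, RKHS.coe_smul, mul_smul_comm]
    exact congrArg (c • ·) (φ.2 f).choose_spec.symm

theorem mulLin_apply (φ : Mult H) (f : H) (x : X) :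
    mulLin φ f x = (φ : X → ℂ) x * f x :=
  congrFun (φ.2 f).choose_spec x

variable [CompleteSpace H]

/-- The multiplication operator `M_φ : f ↦ φ * f`; it is bounded by the closed graph theorem. -/
def mulOp (φ : Mult H) : H →L[ℂ] H where
  toLinearMap := mulLin φ
  cont := by
    refine (mulLin φ).continuous_of_seq_closed_graph ?_
    intro u f g hu hg
    refine RKHS.ext fun x => ?_
    have h1 : Filter.Tendsto (fun n => (mulLin φ (u n)) x) Filter.atTop (nhds (g x)) :=
      ((RKHS.continuous_eval x).tendsto g).comp hg
    have h2 : Filter.Tendsto (fun n => (φ : X → ℂ) x * (u n) x) Filter.atTop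
        (nhds ((φ : X → ℂ) x * f x)) :=
      (((RKHS.continuous_eval x).tendsto f).comp hu).const_mul _
    simp only [mulLin_apply] at h1
    rw [mulLin_apply]
    exact tendsto_nhds_unique h1 h2

theorem mulOp_apply (φ : Mult H) (f : H) (x : X) :
    mulOp φ f x = (φ : X → ℂ) x * f x := mulLin_apply φ f x

/-- An `r × r` matrix of multipliers, regarded as an operator on the Hilbert space direct sum
`H ⊕ ⋯ ⊕ H` of `r` copies of `H`: it sends `(f j)_j` to `(∑ j, A i j * f j)_i`. -/
def matOp {r : ℕ} (A : Matrix (Fin r) (Fin r) (Mult H)) :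
    PiLp 2 (fun _ : Fin r => H) →L[ℂ] PiLp 2 (fun _ : Fin r => H) :=
  ((PiLp.continuousLinearEquiv 2 ℂ (fun _ : Fin r => H)).symm :
      (Fin r → H) →L[ℂ] PiLp 2 (fun _ : Fin r => H)) ∘L
    ContinuousLinearMap.pi
      (fun i => ∑ j, mulOp (A i j) ∘L PiLp.proj 2 (fun _ : Fin r => H) j)

theorem matOp_apply {r : ℕ} (A : Matrix (Fin r) (Fin r) (Mult H))
    (f : PiLp 2 (fun _ : Fin r => H)) (i : Fin r) :
    matOp A f i = ∑ j, mulOp (A i j) (f j) := by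
  simp [matOp]

/-- A linear map between multiplier algebras is completely isometric if for each `r` the map
obtained by applying it entrywise to `r × r` matrices preserves the norm, where a matrix of
multipliers carries the operator norm on the direct sum of `r` copies of the Hilbert space. -/
def IsCompleteIsometry {Y : Type*} {H' : Type*} [NormedAddCommGroup H']
    [InnerProductSpace ℂ H'] [CompleteSpace H'] [RKHS ℂ H' Y ℂ]
    (π : Mult H →ₗ[ℂ] Mult H') : Prop :=
  ∀ (r : ℕ) (A : Matrix (Fin r) (Fin r) (Mult H)), ‖matOp (A.map π)‖ = ‖matOp A‖

end Multipliers

/-! ### Scalar kernels and feature maps -/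

section Kernels

variable {X : Type*}

/-- A scalar valued kernel, as a kernel with values in the operators on `ℂ`. -/
def scalarKernel (k : X → X → ℂ) : Matrix X X (ℂ →L[ℂ] ℂ) :=
  .of fun x y => k x y • (1 : ℂ →L[ℂ] ℂ)

theorem scalarKernel_apply (k : X → X → ℂ) (x y : X) (c : ℂ) :
    scalarKernel k x y c = k x y * c := by
  simp [scalarKernel]

variable {F : Type*} [NormedAddCommGroup F] [InnerProductSpace ℂ F]

theorem posSemidef_of_feature {k : X → X → ℂ} (ψ : X → F)
    (h : ∀ x y, k x y = inner ℂ (ψ x) (ψ y)) : (scalarKernel k).PosSemidef := by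
  have htfae := (RKHS.posSemidef_tfae (K := scalarKernel k)).out 0 2
  rw [htfae]
  refine ⟨?_, fun v => ?_⟩
  · refine Matrix.IsHermitian.ext fun x y => ?_
    ext
    simp [scalarKernel, h]
  · have key : (v.sum fun x w => v.sum fun x' w' => inner ℂ (scalarKernel k x' x w) w')
        = inner ℂ (v.sum fun x w => w • ψ x) (v.sum fun x w => w • ψ x) := by
      simp only [Finsupp.sum, sum_inner, inner_sum]
      rw [Finset.sum_comm]
      refine Finset.sum_congr rfl fun x _ => Finset.sum_congr rfl fun y _ => ?_
      rw [scalarKernel_apply, h, inner_smul_left, inner_smul_right, RCLike.inner_apply, map_mul,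
        inner_conj_symm]
      ring
    rw [key]
    exact inner_self_nonneg

theorem mem_of_feature [CompleteSpace F] {H : Type*} [NormedAddCommGroup H]
    [InnerProductSpace ℂ H] [CompleteSpace H] [RKHS ℂ H X ℂ] (ψ : X → F)
    (h : ∀ x y, RKHS.kernel H x y 1 = inner ℂ (ψ x) (ψ y)) (v : F) :
    ∃ f : H, ∀ x, f x = inner ℂ (ψ x) v := by
  let e : (X →₀ ℂ) →ₗ[ℂ] H := Finsupp.linearCombination ℂ fun x => RKHS.kerFun H x 1
  let t : (X →₀ ℂ) →ₗ[ℂ] F := Finsupp.linearCombination ℂ ψ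
  have hk : ∀ x y, inner ℂ (RKHS.kerFun H x 1) (RKHS.kerFun H y 1) = inner ℂ (ψ x) (ψ y) := by
    intro x y
    rw [RKHS.kerFun_inner, RKHS.kerFun_apply, h]
    simp
  have hin : ∀ c, inner ℂ (t c) (t c) = inner ℂ (e c) (e c) := by
    intro c
    simp only [t, e, Finsupp.linearCombination_apply, Finsupp.sum, sum_inner, inner_sum,
      inner_smul_left, inner_smul_right, hk]
  have hnorm : ∀ c, ‖t c‖ ≤ 1 * ‖e c‖ := by
    intro c
    rw [one_mul, @norm_eq_sqrt_re_inner ℂ, @norm_eq_sqrt_re_inner ℂ, hin]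
  have hd : DenseRange e := by
    have hle : Submodule.span ℂ {RKHS.kerFun H x c | (x : X) (c : ℂ)} ≤ LinearMap.range e := by
      rw [Submodule.span_le]
      rintro _ ⟨x, c, rfl⟩
      refine ⟨Finsupp.single x c, ?_⟩
      simp only [e, Finsupp.linearCombination_single]
      rw [← map_smul, smul_eq_mul, mul_one]
    have h2 := Submodule.topologicalClosure_mono hle
    rw [RKHS.kerFun_dense, top_le_iff] at h2
    have h3 := (Submodule.dense_iff_topologicalClosure_eq_top).mpr h2
    exact h3
  refine ⟨ContinuousLinearMap.adjoint (t.extendOfNorm e) v, fun x => ?_⟩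
  have h1 : t.extendOfNorm e (RKHS.kerFun H x 1) = ψ x := by
    have := LinearMap.extendOfNorm_eq hd ⟨1, hnorm⟩ (Finsupp.single x 1)
    simpa [e, t] using this
  have h2 := RKHS.kerFun_inner x (1 : ℂ) (ContinuousLinearMap.adjoint (t.extendOfNorm e) v)
  rw [ContinuousLinearMap.adjoint_inner_right, h1] at h2
  simpa using h2.symm

end Kernels

/-! ### The Drury--Arveson space -/

section DruryArveson

/-- The open unit disc. -/
abbrev Disc : Type := Metric.ball (0 : ℂ) 1

/-- The open Euclidean unit ball of `ℂ^d`. -/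
abbrev Ball (d : ℕ) : Type := Metric.ball (0 : EuclideanSpace ℂ (Fin d)) 1

variable (d : ℕ)

/-- The kernel `1 / (1 - ∑ i, z i * conj (w i))` on the unit ball. -/
def daKernel (z w : Ball d) : ℂ :=
  1 / (1 - ∑ i, (z : EuclideanSpace ℂ (Fin d)) i * starRingEnd ℂ ((w : EuclideanSpace ℂ (Fin d)) i))

/-- Words of arbitrary length in `d` letters. -/
abbrev Word : Type := Σ n : ℕ, (Fin n → Fin d)

variable {d}

theorem summable_word (x : Ball d) :
    Summable fun s : Word d => ‖∏ i, (x : EuclideanSpace ℂ (Fin d)) (s.2 i)‖ ^ 2 := by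
  have hx : ‖(x : EuclideanSpace ℂ (Fin d))‖ < 1 := mem_ball_zero_iff.mp x.2
  have hn : ∀ n : ℕ, ∑ s : Fin n → Fin d, ‖∏ i, (x : EuclideanSpace ℂ (Fin d)) (s i)‖ ^ 2
      = (‖(x : EuclideanSpace ℂ (Fin d))‖ ^ 2) ^ n := by
    intro n
    rw [EuclideanSpace.norm_sq_eq, Fintype.sum_pow]
    simp [Finset.prod_pow]
  rw [summable_sigma_of_nonneg (fun _ => by positivity)]
  refine ⟨fun n => (hasSum_fintype _).summable, ?_⟩
  simp only [tsum_fintype, hn]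
  exact summable_geometric_of_lt_one (by positivity) (by nlinarith [norm_nonneg (x : EuclideanSpace ℂ (Fin d))])

/-- A feature map for the kernel `daKernel d`. -/
def daFeature (x : Ball d) : lp (fun _ : Word d => ℂ) 2 :=
  ⟨fun s => conj (∏ i, (x : EuclideanSpace ℂ (Fin d)) (s.2 i)), by
    refine memℓp_gen ?_
    simpa using summable_word x⟩

theorem daKernel_eq (x y : Ball d) :
    daKernel d x y = inner ℂ (daFeature x) (daFeature y) := by
  have hx : ‖(x : EuclideanSpace ℂ (Fin d))‖ < 1 := mem_ball_zero_iff.mp x.2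
  have hy : ‖(y : EuclideanSpace ℂ (Fin d))‖ < 1 := mem_ball_zero_iff.mp y.2
  set c : ℂ := ∑ i, (x : EuclideanSpace ℂ (Fin d)) i * starRingEnd ℂ ((y : EuclideanSpace ℂ (Fin d)) i)
    with hc
  have hci : c = inner ℂ (y : EuclideanSpace ℂ (Fin d)) (x : EuclideanSpace ℂ (Fin d)) := by
    rw [PiLp.inner_apply]
    simp [hc]
  have hc1 : ‖c‖ < 1 := by
    rw [hci]
    refine (norm_inner_le_norm _ _).trans_lt ?_
    nlinarith [norm_nonneg (x : EuclideanSpace ℂ (Fin d)),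
      norm_nonneg (y : EuclideanSpace ℂ (Fin d))]
  have h1 := lp.hasSum_inner (𝕜 := ℂ) (daFeature x) (daFeature y)
  have h2 := h1.sigma (fun n => hasSum_fintype _)
  have hn : ∀ n : ℕ, ∑ s : Fin n → Fin d,
      inner ℂ ((daFeature x : Word d → ℂ) ⟨n, s⟩) ((daFeature y : Word d → ℂ) ⟨n, s⟩) = c ^ n := by
    intro n
    rw [hc, Fintype.sum_pow]
    refine Finset.sum_congr rfl fun s _ => ?_
    simp [daFeature, Finset.prod_mul_distrib, mul_comm]
  simp only [hn] at h2
  rw [h2.unique (hasSum_geometric_of_norm_lt_one hc1), daKernel, ← hc, one_div]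

instance daFact (d : ℕ) : Fact (scalarKernel (daKernel d)).PosSemidef :=
  ⟨posSemidef_of_feature daFeature daKernel_eq⟩

/-- The Drury--Arveson space `H²_d`: the reproducing kernel Hilbert space on the unit ball
with kernel `daKernel d`. -/
def DruryArveson (d : ℕ) : Type := RKHS.OfKernel (scalarKernel (daKernel d))

instance (d : ℕ) : NormedAddCommGroup (DruryArveson d) :=
  @UniformSpace.Completion.instNormedAddCommGroup _
    (RKHS.instSeminormedAddCommGroupH₀ (K := scalarKernel (daKernel d)))

instance (d : ℕ) : InnerProductSpace ℂ (DruryArveson d) :=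
  @UniformSpace.Completion.innerProductSpace ℂ _ _
    (RKHS.instSeminormedAddCommGroupH₀ (K := scalarKernel (daKernel d)))
    (RKHS.instInnerProductSpaceH₀ (K := scalarKernel (daKernel d)))

instance (d : ℕ) : CompleteSpace (DruryArveson d) :=
  @UniformSpace.Completion.completeSpace _
    (RKHS.instSeminormedAddCommGroupH₀ (K := scalarKernel (daKernel d))).toUniformSpace

instance (d : ℕ) : RKHS ℂ (DruryArveson d) (Ball d) ℂ :=
  RKHS.OfKernel.instRKHS (K := scalarKernel (daKernel d))

theorem kernel_druryArveson (d : ℕ) :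
    RKHS.kernel (DruryArveson d) = scalarKernel (daKernel d) :=
  RKHS.OfKernel.kernel_ofKernel (K := scalarKernel (daKernel d))

end DruryArveson

/-! ### The map `τ` and the weighted Dirichlet space `H_d` -/

section WeightedDirichlet

/-- `τ z = d ^ (d / 2) * z 1 * ⋯ * z d`. -/
def tau (d : ℕ) (z : EuclideanSpace ℂ (Fin d)) : ℂ :=
  (((d : ℝ) ^ ((d : ℝ) / 2) : ℝ) : ℂ) * ∏ i, z i

theorem norm_tau_sq (d : ℕ) (z : EuclideanSpace ℂ (Fin d)) :
    ‖tau d z‖ ^ 2 = (d : ℝ) ^ d * ∏ i, ‖z i‖ ^ 2 := by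
  have h0 : (0 : ℝ) ≤ d := Nat.cast_nonneg d
  have h1 : ((d : ℝ) ^ ((d : ℝ) / 2)) ^ 2 = (d : ℝ) ^ d := by
    rw [← Real.rpow_natCast, ← Real.rpow_mul h0, ← Real.rpow_natCast]
    norm_num
  rw [tau, norm_mul, mul_pow, norm_prod, Finset.prod_pow, Complex.norm_real, Real.norm_eq_abs,
    sq_abs, h1]

theorem norm_tau_lt_one {d : ℕ} [NeZero d] (z : Ball d) : ‖tau d z‖ < 1 := by
  have hd : (0 : ℝ) < d := Nat.cast_pos.mpr (Nat.pos_of_ne_zero (NeZero.ne d))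
  have hz : ‖(z : EuclideanSpace ℂ (Fin d))‖ < 1 := mem_ball_zero_iff.mp z.2
  set p : Fin d → ℝ := fun i => ‖(z : EuclideanSpace ℂ (Fin d)) i‖ ^ 2 with hp
  have hp0 : ∀ i, 0 ≤ p i := fun i => by positivity
  have hs : ∑ i, p i < 1 := by
    rw [hp, ← EuclideanSpace.norm_sq_eq]
    nlinarith [norm_nonneg (z : EuclideanSpace ℂ (Fin d))]
  have hs0 : 0 ≤ ∑ i, p i := Finset.sum_nonneg fun i _ => hp0 i
  have h := Real.geom_mean_le_arith_mean_weighted Finset.univ (fun _ : Fin d => (d : ℝ)⁻¹) p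
    (fun i _ => by positivity) (by simp [hd.ne']) (fun i _ => hp0 i)
  rw [← Finset.mul_sum] at h
  have h2 := pow_le_pow_left₀ (Finset.prod_nonneg fun i _ => Real.rpow_nonneg (hp0 i) _) h d
  rw [← Finset.prod_pow] at h2
  simp only [Real.rpow_inv_natCast_pow (hp0 _) (NeZero.ne d)] at h2
  have h3 : ‖tau d z‖ ^ 2 < 1 := by
    rw [norm_tau_sq]
    calc (d : ℝ) ^ d * ∏ i, p i ≤ (d : ℝ) ^ d * ((d : ℝ)⁻¹ * ∑ i, p i) ^ d := by gcongr
      _ = (∑ i, p i) ^ d := by rw [← mul_pow, mul_inv_cancel_left₀ hd.ne']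
      _ < 1 := pow_lt_one₀ hs0 hs (NeZero.ne d)
  nlinarith [norm_nonneg (tau d (z : EuclideanSpace ℂ (Fin d)))]

/-- `τ` as a map from the unit ball to the unit disc. -/
def tauMap (d : ℕ) [NeZero d] (z : Ball d) : Disc :=
  ⟨tau d z, mem_ball_zero_iff.mpr (norm_tau_lt_one z)⟩

theorem exists_tauPow (d n : ℕ) :
    ∃ f : DruryArveson d, ∀ z : Ball d, f z = tau d z ^ n := by
  obtain ⟨f, hf⟩ := mem_of_feature (H := DruryArveson d) daFeature
    (fun x y => by rw [kernel_druryArveson, scalarKernel_apply, mul_one, daKernel_eq])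
    (lp.single 2 (⟨n * d, fun i => (finProdFinEquiv.symm i).2⟩ : Word d)
      ((((d : ℝ) ^ ((d : ℝ) / 2) : ℝ) : ℂ) ^ n))
  refine ⟨f, fun z => ?_⟩
  rw [hf, lp.inner_single_right]
  have : ∏ i : Fin (n * d), (z : EuclideanSpace ℂ (Fin d)) (finProdFinEquiv.symm i).2
      = (∏ i, (z : EuclideanSpace ℂ (Fin d)) i) ^ n := by
    rw [Equiv.prod_comp finProdFinEquiv.symm
      (fun q : Fin n × Fin d => (z : EuclideanSpace ℂ (Fin d)) q.2), Fintype.prod_prod_type]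
    simp
  rw [RCLike.inner_apply, tau, mul_pow, ← this]
  simp [daFeature]

/-- The function `τ ^ n`, as an element of the Drury--Arveson space. -/
def tauPow (d n : ℕ) : DruryArveson d := (exists_tauPow d n).choose

theorem tauPow_apply (d n : ℕ) (z : Ball d) : tauPow d n z = tau d z ^ n :=
  (exists_tauPow d n).choose_spec z

/-- The weights `a_n = ‖τ ^ n‖ ^ (-2)`, the norm being that of the Drury--Arveson space. -/
def weight (d n : ℕ) : ℝ := (‖tauPow d n‖ ^ 2)⁻¹

theorem weight_nonneg (d n : ℕ) : 0 ≤ weight d n := by unfold weight; positivity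

/-- The kernel `∑ n, a_n * (z * conj w) ^ n` on the unit disc. -/
def hdKernel (d : ℕ) (z w : Disc) : ℂ :=
  ∑' n : ℕ, (weight d n : ℂ) * ((z : ℂ) * conj (w : ℂ)) ^ n

theorem exists_tau_eq (d : ℕ) [NeZero d] {t : ℝ} (ht : 0 ≤ t) (ht1 : t < 1) :
    ∃ z : Ball d, ‖tau d z‖ = t := by
  have hd : (0 : ℝ) < d := Nat.cast_pos.mpr (Nat.pos_of_ne_zero (NeZero.ne d))
  set q : ℝ := t ^ ((d : ℝ)⁻¹) with hq
  have hq0 : 0 ≤ q := Real.rpow_nonneg ht _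
  have hqd : q ^ d = t := Real.rpow_inv_natCast_pow ht (NeZero.ne d)
  have hq1 : q < 1 := Real.rpow_lt_one ht ht1 (by positivity)
  let z : EuclideanSpace ℂ (Fin d) := WithLp.toLp 2 fun _ => ((q / √d : ℝ) : ℂ)
  have hzi : ∀ i, ‖z i‖ ^ 2 = q ^ 2 / d := by
    intro i
    simp only [z, Complex.norm_real, Real.norm_eq_abs, sq_abs, div_pow, Real.sq_sqrt hd.le]
  have hz : ‖z‖ ^ 2 = q ^ 2 := by
    rw [EuclideanSpace.norm_sq_eq]
    simp only [hzi]
    simp only [Finset.sum_const, Finset.card_univ, Fintype.card_fin, nsmul_eq_mul]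
    field_simp
  have hz1 : ‖z‖ < 1 := by nlinarith [norm_nonneg z]
  refine ⟨⟨z, mem_ball_zero_iff.mpr hz1⟩, ?_⟩
  have h2 : ‖tau d z‖ ^ 2 = t ^ 2 := by
    rw [norm_tau_sq]
    simp only [hzi]
    simp only [Finset.prod_const, Finset.card_univ, Fintype.card_fin]
    rw [← mul_pow, mul_div_cancel₀ _ hd.ne', ← hqd]
    ring
  exact (pow_left_inj₀ (norm_nonneg _) ht two_ne_zero).mp h2

theorem weight_le (d : ℕ) [NeZero d] {t : ℝ} (ht : 0 < t) (ht1 : t < 1) :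
    ∃ C : ℝ, ∀ n, weight d n ≤ C * ((t ^ 2)⁻¹) ^ n := by
  obtain ⟨z, hz⟩ := exists_tau_eq d ht.le ht1
  refine ⟨‖RKHS.kernel (DruryArveson d) z z‖, fun n => ?_⟩
  have h := RKHS.norm_apply_le (tauPow d n) z
  rw [tauPow_apply, norm_pow, hz] at h
  have hp : 0 < t ^ n := pow_pos ht n
  have h2 := pow_le_pow_left₀ hp.le h 2
  rw [mul_pow, Real.sq_sqrt (norm_nonneg _)] at h2
  have hN : 0 < ‖tauPow d n‖ ^ 2 := by
    rcases (sq_nonneg ‖tauPow d n‖).lt_or_eq with h3 | h3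
    · exact h3
    · rw [← h3, zero_mul] at h2
      exact absurd h2 (not_le.mpr (by positivity))
  rw [weight, inv_pow, ← div_eq_mul_inv, le_div_iff₀ (by positivity), inv_mul_le_iff₀ hN,
    ← pow_mul, mul_comm 2 n, pow_mul]
  exact h2

theorem summable_weight (d : ℕ) [NeZero d] {x : ℝ} (hx : 0 ≤ x) (hx1 : x < 1) :
    Summable fun n => weight d n * x ^ n := by
  obtain ⟨y, hxy, hy1⟩ := exists_between hx1
  have hy : 0 < y := hx.trans_lt hxy
  obtain ⟨C, hC⟩ := weight_le d (t := √y) (Real.sqrt_pos.mpr hy)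
    (by rw [Real.sqrt_lt' one_pos]; simpa using hy1)
  rw [Real.sq_sqrt hy.le] at hC
  have hg : Summable fun n : ℕ => C * (y⁻¹ * x) ^ n :=
    (summable_geometric_of_lt_one (by positivity) (by rwa [inv_mul_lt_one₀ hy])).mul_left C
  refine hg.of_nonneg_of_le (fun n => mul_nonneg (weight_nonneg d n) (by positivity)) fun n => ?_
  rw [mul_pow, ← mul_assoc]
  exact mul_le_mul_of_nonneg_right (hC n) (by positivity)

/-- A feature map for the kernel `hdKernel d`. -/
def hdFeature (d : ℕ) [NeZero d] (z : Disc) : lp (fun _ : ℕ => ℂ) 2 :=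
  ⟨fun n => ((√(weight d n) : ℝ) : ℂ) * conj (z : ℂ) ^ n, by
    have hz : ‖(z : ℂ)‖ < 1 := mem_ball_zero_iff.mp z.2
    refine memℓp_gen ?_
    refine (summable_weight d (sq_nonneg ‖(z : ℂ)‖)
      (by nlinarith [norm_nonneg (z : ℂ)])).congr fun n => ?_
    simp only [ENNReal.toReal_ofNat, Real.rpow_ofNat, norm_mul, Complex.norm_real,
      Real.norm_eq_abs, mul_pow, sq_abs, Real.sq_sqrt (weight_nonneg d n), norm_pow,
      RCLike.norm_conj]
    ring⟩

theorem hdKernel_eq (d : ℕ) [NeZero d] (z w : Disc) :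
    hdKernel d z w = inner ℂ (hdFeature d z) (hdFeature d w) := by
  rw [hdKernel, lp.inner_eq_tsum]
  refine tsum_congr fun n => ?_
  have h : ((√(weight d n) : ℝ) : ℂ) * ((√(weight d n) : ℝ) : ℂ) = (weight d n : ℂ) := by
    rw [← Complex.ofReal_mul, Real.mul_self_sqrt (weight_nonneg d n)]
  simp only [hdFeature, RCLike.inner_apply, map_mul, map_pow, Complex.conj_conj,
    Complex.conj_ofReal]
  rw [← h]
  ring

/-- The series defining `hdKernel` converges. -/
theorem hasSum_hdKernel (d : ℕ) [NeZero d] (z w : Disc) :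
    HasSum (fun n : ℕ => (weight d n : ℂ) * ((z : ℂ) * conj (w : ℂ)) ^ n) (hdKernel d z w) := by
  have hz : ‖(z : ℂ)‖ < 1 := mem_ball_zero_iff.mp z.2
  have hw : ‖(w : ℂ)‖ < 1 := mem_ball_zero_iff.mp w.2
  refine (Summable.of_norm ?_).hasSum
  refine (summable_weight d (x := ‖(z : ℂ)‖ * ‖(w : ℂ)‖) (by positivity)
    (by nlinarith [norm_nonneg (z : ℂ), norm_nonneg (w : ℂ)])).congr fun n => ?_
  simp [abs_of_nonneg (weight_nonneg d n)]

instance hdFact (d : ℕ) [NeZero d] : Fact (scalarKernel (hdKernel d)).PosSemidef :=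
  ⟨posSemidef_of_feature (hdFeature d) (hdKernel_eq d)⟩

/-- The weighted Dirichlet space `H_d`: the reproducing kernel Hilbert space on the unit disc
with kernel `hdKernel d`. -/
def WeightedDirichlet (d : ℕ) [NeZero d] : Type := RKHS.OfKernel (scalarKernel (hdKernel d))

instance (d : ℕ) [NeZero d] : NormedAddCommGroup (WeightedDirichlet d) :=
  @UniformSpace.Completion.instNormedAddCommGroup _
    (RKHS.instSeminormedAddCommGroupH₀ (K := scalarKernel (hdKernel d)))

instance (d : ℕ) [NeZero d] : InnerProductSpace ℂ (WeightedDirichlet d) :=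
  @UniformSpace.Completion.innerProductSpace ℂ _ _
    (RKHS.instSeminormedAddCommGroupH₀ (K := scalarKernel (hdKernel d)))
    (RKHS.instInnerProductSpaceH₀ (K := scalarKernel (hdKernel d)))

instance (d : ℕ) [NeZero d] : CompleteSpace (WeightedDirichlet d) :=
  @UniformSpace.Completion.completeSpace _
    (RKHS.instSeminormedAddCommGroupH₀ (K := scalarKernel (hdKernel d))).toUniformSpace

instance (d : ℕ) [NeZero d] : RKHS ℂ (WeightedDirichlet d) Disc ℂ :=
  RKHS.OfKernel.instRKHS (K := scalarKernel (hdKernel d))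

theorem kernel_weightedDirichlet (d : ℕ) [NeZero d] :
    RKHS.kernel (WeightedDirichlet d) = scalarKernel (hdKernel d) :=
  RKHS.OfKernel.kernel_ofKernel (K := scalarKernel (hdKernel d))

end WeightedDirichlet

end MultEmbed

end

/-! Expanding `1 / (1 - ⟨x, y⟩)` as a geometric series writes the Drury--Arveson kernel `k` as a sum
over words `s` in `d` letters of `mon x s * conj (mon y s)`. Every word factors uniquely as a word
with no nonempty balanced suffix followed by a balanced word (`suffixEquiv`), and `mon` is
multiplicative, so `k` is the product of a positive kernel, summed over suffix-free words, and a sum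
over balanced words. There are `N_n` words containing each letter exactly `n` times, and they share
the monomial `(∏ i, x i) ^ n`. Since `weight d n = N_n / d ^ (d * n)` (`weight_eq`), the balanced
sum is exactly the kernel `K` of `H_d` composed with `τ` (`hasSum_mon_balanced`).

Upper bound: the factorization gives an isometry `V` from `H²_d` into a direct sum of copies of
`H_d`, indexed by suffix-free words. Multiplication by `φ ∘ τ` is `V* (M_φ ⊗ 1) V`
(`factorEmb_adjoint_entrywise`). This shows both that `φ ∘ τ` is a multiplier and that matrix norms
do not increase.

Lower bound: `f ↦ f ∘ τ` is an isometry from `H_d` into `H²_d` (`exists_isometry_comp_tau`) that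
intertwines `M_φ` with `M_{φ ∘ τ}`, so matrix norms do not decrease.

Norms in `H²_d` are computed in the full Fock space `ℓ²(words)`. A vector orthogonal to the kernel
of the adjoint embedding lies in the range of the embedding, and elements of that kernel have
coefficients summing to zero over the words with each letter occurring `n` times
(`sum_balancedWords_eq_zero`). -/

namespace MultEmbed

open scoped ComplexConjugate

attribute [local instance 2000] InnerProductSpace.toInner

/-! ### Isometries induced by feature maps, and their adjoints -/

section Feature

variable {X H F : Type*} [NormedAddCommGroup H] [InnerProductSpace ℂ H] [CompleteSpace H]
  [RKHS ℂ H X ℂ] [NormedAddCommGroup F] [InnerProductSpace ℂ F] [CompleteSpace F]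

/-- A feature map for the kernel of `H` induces an isometric embedding of `H`. -/
theorem exists_isometry_of_feature (ψ : X → F)
    (h : ∀ x y, RKHS.kernel H x y 1 = inner ℂ (ψ x) (ψ y)) :
    ∃ V : H →ₗᵢ[ℂ] F, ∀ x, V (RKHS.kerFun H x 1) = ψ x := by
  let e : (X →₀ ℂ) →ₗ[ℂ] H := Finsupp.linearCombination ℂ fun x => RKHS.kerFun H x 1
  let t : (X →₀ ℂ) →ₗ[ℂ] F := Finsupp.linearCombination ℂ ψ
  have hk : ∀ x y, inner ℂ (RKHS.kerFun H x 1) (RKHS.kerFun H y 1) = inner ℂ (ψ x) (ψ y) := by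
    intro x y
    rw [RKHS.kerFun_inner, RKHS.kerFun_apply, h]
    simp
  -- Equal Gram matrices make `e c ↦ t c` well defined and isometric on the dense span of kernel
  -- functions.
  have hin : ∀ c, inner ℂ (t c) (t c) = inner ℂ (e c) (e c) := by
    intro c
    simp only [t, e, Finsupp.linearCombination_apply, Finsupp.sum, sum_inner, inner_sum,
      inner_smul_left, inner_smul_right, hk]
  have hnorm : ∀ c, ‖t c‖ = ‖e c‖ := by
    intro c
    rw [@norm_eq_sqrt_re_inner ℂ, @norm_eq_sqrt_re_inner ℂ, hin]
  have hd : DenseRange e := by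
    have hle : Submodule.span ℂ {RKHS.kerFun H x c | (x : X) (c : ℂ)} ≤ LinearMap.range e := by
      rw [Submodule.span_le]
      rintro _ ⟨x, c, rfl⟩
      refine ⟨Finsupp.single x c, ?_⟩
      simp only [e, Finsupp.linearCombination_single]
      rw [← map_smul, smul_eq_mul, mul_one]
    have h2 := Submodule.topologicalClosure_mono hle
    rw [RKHS.kerFun_dense, top_le_iff] at h2
    have h3 := (Submodule.dense_iff_topologicalClosure_eq_top).mpr h2
    exact h3
  have hext : ∀ c, t.extendOfNorm e (e c) = t c := fun c =>
    LinearMap.extendOfNorm_eq hd ⟨1, fun c => by rw [one_mul, hnorm]⟩ c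
  refine ⟨⟨(t.extendOfNorm e).toLinearMap, fun f => ?_⟩, fun x => ?_⟩
  · change ‖t.extendOfNorm e f‖ = ‖f‖
    refine hd.induction_on (p := fun f => ‖t.extendOfNorm e f‖ = ‖f‖) f
      (isClosed_eq (by fun_prop) (by fun_prop)) fun c => ?_
    rw [hext, hnorm]
  · simpa [e, t] using hext (Finsupp.single x 1)

theorem adjoint_apply_of_feature {ψ : X → F} {V : H →ₗᵢ[ℂ] F}
    (hV : ∀ x, V (RKHS.kerFun H x 1) = ψ x) (v : F) (x : X) :
    (V.toContinuousLinearMap.adjoint v) x = inner ℂ (ψ x) v := by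
  have h2 := RKHS.kerFun_inner x (1 : ℂ) (V.toContinuousLinearMap.adjoint v)
  rw [ContinuousLinearMap.adjoint_inner_right, LinearIsometry.coe_toContinuousLinearMap, hV] at h2
  simpa using h2.symm

theorem adjoint_apply_isometry (V : H →ₗᵢ[ℂ] F) (f : H) :
    V.toContinuousLinearMap.adjoint (V f) = f := by
  refine ext_inner_left ℂ fun g => ?_
  rw [ContinuousLinearMap.adjoint_inner_right, LinearIsometry.coe_toContinuousLinearMap,
    V.inner_map_map]

theorem norm_adjoint_isometry_le (V : H →ₗᵢ[ℂ] F) (v : F) :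
    ‖V.toContinuousLinearMap.adjoint v‖ ≤ ‖v‖ := by
  refine (ContinuousLinearMap.le_opNorm _ _).trans ?_
  rw [LinearIsometryEquiv.norm_map]
  exact mul_le_of_le_one_left (norm_nonneg _) V.norm_toContinuousLinearMap_le

/-- A vector orthogonal to the kernel of the adjoint lies in the range of an isometry. -/
theorem isometry_adjoint_of_orthogonal (V : H →ₗᵢ[ℂ] F) {q : F}
    (h : ∀ v, V.toContinuousLinearMap.adjoint v = 0 → inner ℂ v q = 0) :
    V (V.toContinuousLinearMap.adjoint q) = q := by
  set T := V.toContinuousLinearMap.adjoint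
  -- The defect `q - V (T q)` lies in the kernel of `T`, so it is orthogonal to `q` by hypothesis
  -- and to the range of `V`; hence it is orthogonal to itself.
  have h0 : T (q - V (T q)) = 0 := by rw [map_sub, adjoint_apply_isometry, sub_self]
  have h1 := h _ h0
  have h2 : inner ℂ (q - V (T q)) (V (T q)) = 0 := by
    have := ContinuousLinearMap.adjoint_inner_left V.toContinuousLinearMap (T q) (q - V (T q))
    rw [h0, inner_zero_left] at this
    exact this.symm
  have h3 : inner ℂ (q - V (T q)) (q - V (T q)) = 0 := by rw [inner_sub_right, h1, h2, sub_zero]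
  exact (sub_eq_zero.mp (inner_self_eq_zero.mp h3)).symm

theorem inner_adjoint_of_isometry_adjoint (V : H →ₗᵢ[ℂ] F) {q : F} (p : F)
    (h : V (V.toContinuousLinearMap.adjoint q) = q) :
    inner ℂ (V.toContinuousLinearMap.adjoint p) (V.toContinuousLinearMap.adjoint q)
      = inner ℂ p q := by
  rw [ContinuousLinearMap.adjoint_inner_left, LinearIsometry.coe_toContinuousLinearMap, h]

end Feature

/-! ### Unique factorization of words by their balanced suffix -/

section Words

variable {α : Type*} [DecidableEq α]

/-- A word is balanced if all letters occur equally often. -/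
def Balanced (s : List α) : Prop := ∀ i j, s.count i = s.count j

theorem balanced_nil : Balanced ([] : List α) := fun i j => by simp

theorem Balanced.append {s t : List α} (hs : Balanced s) (ht : Balanced t) :
    Balanced (s ++ t) := fun i j => by
  rw [List.count_append, List.count_append, hs i j, ht i j]

theorem Balanced.of_append {s t : List α} (h : Balanced (s ++ t)) (ht : Balanced t) :
    Balanced s := fun i j => by
  have := h i j
  rw [List.count_append, List.count_append, ht i j] at this
  omega

/-- Words without nonempty balanced suffix. -/
def SuffixFree (u : List α) : Prop := ∀ w, w <:+ u → Balanced w → w = []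

/-- Nonempty balanced suffixes are stripped off until none remains; the stripped pieces concatenate
to a balanced word. -/
theorem exists_suffixFree_append (s : List α) :
    ∃ u v, SuffixFree u ∧ Balanced v ∧ u ++ v = s := by
  induction hn : s.length using Nat.strong_induction_on generalizing s with
  | _ n ih =>
    by_cases h : SuffixFree s
    · exact ⟨s, [], h, balanced_nil, by simp⟩
    · simp only [SuffixFree, not_forall] at h
      obtain ⟨w, ⟨t, rfl⟩, hw, hne⟩ := h
      have hl : 0 < w.length := List.length_pos_iff.mpr hne
      rw [List.length_append] at hn
      obtain ⟨u, v, hu, hv, rfl⟩ := ih t.length (by omega) t rfl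
      exact ⟨u, v ++ w, hu, hv.append hw, by simp⟩

/-- Two factorizations of one word differ by a middle piece. It is a suffix of one of the first
factors, and it is balanced because cancelling a balanced suffix preserves balance, so it is empty.
-/
theorem suffixFree_append_unique {u v u' v' : List α} (hu : SuffixFree u) (hv : Balanced v)
    (hu' : SuffixFree u') (hv' : Balanced v') (h : u ++ v = u' ++ v') : u = u' ∧ v = v' := by
  rcases List.append_eq_append_iff.mp h with ⟨a, rfl, rfl⟩ | ⟨a, rfl, rfl⟩
  · simp [hu' a (List.suffix_append _ _) (hv.of_append hv')]
  · simp [hu a (List.suffix_append _ _) (hv'.of_append hv)]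

variable (α) in
/-- Every word is uniquely the concatenation of a word without nonempty balanced suffix and a
balanced word. -/
noncomputable def suffixEquiv : {u : List α // SuffixFree u} × {v : List α // Balanced v} ≃ List α :=
  Equiv.ofBijective (fun p => p.1.1 ++ p.2.1) ⟨by
    rintro ⟨⟨u, hu⟩, ⟨v, hv⟩⟩ ⟨⟨u', hu'⟩, ⟨v', hv'⟩⟩ h
    obtain ⟨rfl, rfl⟩ := suffixFree_append_unique hu hv hu' hv' h
    rfl, fun s => by
    obtain ⟨u, v, hu, hv, h⟩ := exists_suffixFree_append s
    exact ⟨(⟨u, hu⟩, ⟨v, hv⟩), h⟩⟩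

theorem suffixEquiv_apply (p : {u : List α // SuffixFree u} × {v : List α // Balanced v}) :
    suffixEquiv α p = p.1.1 ++ p.2.1 := rfl

variable [Fintype α]

theorem sum_count_eq_length (s : List α) : ∑ i, s.count i = s.length := by
  rw [← List.sum_toFinset_count_eq_length]
  refine (Finset.sum_subset (Finset.subset_univ _) fun i _ hi => ?_).symm
  exact List.count_eq_zero.mpr (by simpa using hi)

theorem prod_map_eq_prod_pow_count {M : Type*} [CommMonoid M] (x : α → M) (s : List α) :
    (s.map x).prod = ∏ i, x i ^ s.count i := by
  rw [Finset.prod_list_map_count]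
  refine Finset.prod_subset (Finset.subset_univ _) fun i _ hi => ?_
  rw [List.count_eq_zero.mpr (by simpa using hi), pow_zero]

variable (α) in
theorem finite_count_eq (n : ℕ) : {s : List α | ∀ i, s.count i = n}.Finite := by
  refine (List.finite_length_eq α (Fintype.card α * n)).subset fun s hs => ?_
  rw [Set.mem_ofPred_eq, ← sum_count_eq_length, Finset.sum_congr rfl fun i _ => hs i]
  simp

variable (α) in
/-- The words in which every letter occurs exactly `n` times. -/
noncomputable def balancedWords (n : ℕ) : Finset (List α) := (finite_count_eq α n).toFinset

@[simp]
theorem mem_balancedWords {n : ℕ} {s : List α} :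
    s ∈ balancedWords α n ↔ ∀ i, s.count i = n := by
  simp [balancedWords]

theorem balancedWords_nonempty (n : ℕ) : (balancedWords α n).Nonempty := by
  -- The witness lists the whole alphabet `n` times.
  refine ⟨(List.replicate n Finset.univ.toList).flatten, ?_⟩
  rw [mem_balancedWords]
  intro i
  have : List.count i (Finset.univ : Finset α).toList = 1 :=
    List.count_eq_one_of_mem (Finset.nodup_toList _) (by simp)
  simp [List.count_flatten, this]

variable (α) in
/-- Balanced words, sorted by the number of occurrences of a letter. -/
noncomputable def balancedEquiv [Nonempty α] : (Σ n, balancedWords α n) ≃ {s : List α // Balanced s} where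
  toFun p := ⟨p.2.1, fun i j => by
    have := mem_balancedWords.mp p.2.2
    rw [this i, this j]⟩
  invFun s := ⟨s.1.count (Classical.arbitrary α), s.1, mem_balancedWords.mpr fun i => s.2 _ _⟩
  left_inv := by
    rintro ⟨n, s, hs⟩
    obtain rfl := mem_balancedWords.mp hs (Classical.arbitrary α)
    rfl
  right_inv s := rfl

theorem balancedEquiv_apply [Nonempty α] (p : Σ n, balancedWords α n) :
    (balancedEquiv α p : List α) = p.2.1 := rfl

end Words

/-! ### The full Fock space and the kernel of the adjoint embedding -/

section WordFeature

variable {d : ℕ}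

/-- The monomial belonging to a word. -/
noncomputable def mon (x : EuclideanSpace ℂ (Fin d)) (s : List (Fin d)) : ℂ := (s.map fun i => x i).prod

theorem mon_append (x : EuclideanSpace ℂ (Fin d)) (s t : List (Fin d)) :
    mon x (s ++ t) = mon x s * mon x t := by simp [mon]

theorem mon_ofFn (x : EuclideanSpace ℂ (Fin d)) {n : ℕ} (t : Fin n → Fin d) :
    mon x (List.ofFn t) = ∏ i, x (t i) := by
  simp [mon, List.prod_ofFn]

theorem mon_smul (z : ℂ) (x : EuclideanSpace ℂ (Fin d)) (s : List (Fin d)) :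
    mon (z • x) s = z ^ s.length * mon x s := by
  induction s with
  | nil => simp [mon]
  | cons a s ih =>
    simp only [mon, List.map_cons, List.prod_cons, List.length_cons] at ih ⊢
    rw [ih, PiLp.smul_apply, smul_eq_mul]
    ring

theorem mon_eq_prod_pow (x : EuclideanSpace ℂ (Fin d)) (s : List (Fin d)) :
    mon x s = ∏ i, x i ^ s.count i := prod_map_eq_prod_pow_count _ s

theorem mon_of_mem_balancedWords (x : EuclideanSpace ℂ (Fin d)) {n : ℕ} {s : List (Fin d)}
    (hs : s ∈ balancedWords (Fin d) n) : mon x s = (∏ i, x i) ^ n := by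
  rw [mon_eq_prod_pow, ← Finset.prod_pow]
  exact Finset.prod_congr rfl fun i _ => by rw [mem_balancedWords.mp hs i]

theorem summable_norm_mon_sq (x : Ball d) :
    Summable fun s : List (Fin d) => ‖mon (x : EuclideanSpace ℂ (Fin d)) s‖ ^ 2 := by
  rw [← List.equivSigmaTuple.symm.summable_iff]
  refine (summable_word x).congr fun s => ?_
  rw [← mon_ofFn]
  rfl

theorem hasSum_mon (x y : Ball d) :
    HasSum (fun s : List (Fin d) => mon (x : EuclideanSpace ℂ (Fin d)) s *
      conj (mon (y : EuclideanSpace ℂ (Fin d)) s)) (daKernel d x y) := by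
  rw [← List.equivSigmaTuple.symm.hasSum_iff, daKernel_eq]
  refine (lp.hasSum_inner (𝕜 := ℂ) (daFeature x) (daFeature y)).congr_fun ?_
  rintro ⟨n, t⟩
  change mon x.1 (List.ofFn t) * conj (mon y.1 (List.ofFn t)) = _
  rw [mon_ofFn, mon_ofFn]
  simp [daFeature, mul_comm]

/-- The feature map of the Drury--Arveson kernel indexed by words. -/
noncomputable def wordFeature (x : Ball d) : lp (fun _ : List (Fin d) => ℂ) 2 :=
  ⟨fun s => conj (mon (x : EuclideanSpace ℂ (Fin d)) s), by
    refine memℓp_gen ?_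
    simpa using summable_norm_mon_sq x⟩

theorem wordFeature_apply (x : Ball d) (s : List (Fin d)) :
    wordFeature x s = conj (mon (x : EuclideanSpace ℂ (Fin d)) s) := rfl

theorem kernel_eq_inner_wordFeature (x y : Ball d) :
    RKHS.kernel (DruryArveson d) x y 1 = inner ℂ (wordFeature x) (wordFeature y) := by
  rw [kernel_druryArveson, scalarKernel_apply, mul_one]
  refine (hasSum_mon x y).unique ((lp.hasSum_inner (𝕜 := ℂ) _ _).congr_fun fun s => ?_)
  simp [wordFeature_apply, mul_comm]

/-- The isometric embedding of the Drury--Arveson space into the full Fock space. -/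
noncomputable def fock (d : ℕ) : DruryArveson d →ₗᵢ[ℂ] lp (fun _ : List (Fin d) => ℂ) 2 :=
  (exists_isometry_of_feature wordFeature kernel_eq_inner_wordFeature).choose

theorem fock_kerFun (x : Ball d) : fock d (RKHS.kerFun (DruryArveson d) x 1) = wordFeature x :=
  (exists_isometry_of_feature wordFeature kernel_eq_inner_wordFeature).choose_spec x

theorem fock_adjoint_apply (v : lp (fun _ : List (Fin d) => ℂ) 2) (x : Ball d) :
    ((fock d).toContinuousLinearMap.adjoint v) x = inner ℂ (wordFeature x) v :=
  adjoint_apply_of_feature fock_kerFun v x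

/-- Uniqueness of power series coefficients. -/
theorem eq_zero_of_hasSum_pow_mul {c : ℕ → ℂ}
    (h : ∀ z : ℂ, ‖z‖ < 1 → HasSum (fun n => z ^ n * c n) 0) (n : ℕ) : c n = 0 := by
  have h1 : HasFPowerSeriesAt 0 (FormalMultilinearSeries.ofScalars ℂ c) (0 : ℂ) := by
    rw [hasFPowerSeriesAt_iff]
    filter_upwards [Metric.ball_mem_nhds (0 : ℂ) one_pos] with z hz
    simpa [FormalMultilinearSeries.coeff_ofScalars] using h z (mem_ball_zero_iff.mp hz)
  have h2 := congrArg (fun p => p.coeff n) h1.eq_zero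
  simp only [FormalMultilinearSeries.coeff_ofScalars] at h2
  rw [h2]
  rfl

/-- Replacing `x` by `z • x` multiplies the monomial of a word by `z` to its length. Grouping words
by length gives a power series in `z` that vanishes on the disc, so each homogeneous part vanishes.
-/
theorem sum_length_eq_zero {v : lp (fun _ : List (Fin d) => ℂ) 2}
    (h : ∀ x : Ball d, inner ℂ (wordFeature x) v = 0) (m : ℕ) (x : Ball d) :
    ∑ s ∈ (List.finite_length_eq (Fin d) m).toFinset,
      v s * mon (x : EuclideanSpace ℂ (Fin d)) s = 0 := by
  refine eq_zero_of_hasSum_pow_mul (c := fun m =>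
    ∑ s ∈ (List.finite_length_eq (Fin d) m).toFinset,
      v s * mon (x : EuclideanSpace ℂ (Fin d)) s) (fun z hz => ?_) m
  have hx : ‖(x : EuclideanSpace ℂ (Fin d))‖ < 1 := mem_ball_zero_iff.mp x.2
  have hzx : z • (x : EuclideanSpace ℂ (Fin d)) ∈ Metric.ball 0 1 := by
    rw [mem_ball_zero_iff, norm_smul]
    exact mul_lt_one_of_nonneg_of_lt_one_left (norm_nonneg _) hz hx.le
  have h1 := lp.hasSum_inner (𝕜 := ℂ) (wordFeature ⟨_, hzx⟩) v
  rw [h, ← (Equiv.sigmaFiberEquiv List.length).hasSum_iff] at h1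
  have hfin : ∀ m : ℕ, Finite {s : List (Fin d) // s.length = m} := fun m =>
    (List.finite_length_eq (Fin d) m).to_subtype
  have := fun m => Fintype.ofFinite {s : List (Fin d) // s.length = m}
  refine (h1.sigma fun m => hasSum_fintype _).congr_fun fun m => ?_
  rw [Finset.mul_sum, Finset.sum_subtype (p := fun s => s.length = m) _ (by simp)]
  refine Finset.sum_congr rfl fun s _ => ?_
  simp only [Function.comp_apply, Equiv.sigmaFiberEquiv_apply, RCLike.inner_apply,
    wordFeature_apply, Complex.conj_conj, mon_smul, s.2]
  ring

/-- The homogeneous part of degree `d * n` is a polynomial vanishing on the ball, hence zero; the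
sum in question is its coefficient at the exponent `(n, …, n)`. -/
theorem sum_balancedWords_eq_zero {v : lp (fun _ : List (Fin d) => ℂ) 2}
    (h : ∀ x : Ball d, inner ℂ (wordFeature x) v = 0) (n : ℕ) :
    ∑ s ∈ balancedWords (Fin d) n, v s = 0 := by
  let e : List (Fin d) → (Fin d →₀ ℕ) := fun s => Finsupp.equivFunOnFinite.symm fun i => s.count i
  let P : MvPolynomial (Fin d) ℂ := ∑ s ∈ (List.finite_length_eq (Fin d) (d * n)).toFinset,
    MvPolynomial.monomial (e s) (v s)
  have hP : P = 0 := by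
    -- A polydisc of radius `1 / (d + 1)` fits in the unit ball, since there `∑ i, ‖x i‖ ^ 2 ≤ d /
    -- (d + 1) < 1`.
    refine MvPolynomial.funext_set (fun _ => Metric.ball (0 : ℂ) (1 / (d + 1))) (fun _ =>
      infinite_of_mem_nhds 0 (Metric.ball_mem_nhds _ (by positivity))) fun x hx => ?_
    have hx1 : WithLp.toLp 2 x ∈ Metric.ball (0 : EuclideanSpace ℂ (Fin d)) 1 := by
      rw [mem_ball_zero_iff, EuclideanSpace.norm_eq, Real.sqrt_lt' one_pos]
      have h1 : ∀ i ∈ Finset.univ, ‖x i‖ ^ 2 ≤ 1 / ((d : ℝ) + 1) := fun i _ => by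
        have h2 : ‖x i‖ < 1 / ((d : ℝ) + 1) := mem_ball_zero_iff.mp (hx i trivial)
        have h3 : 1 / ((d : ℝ) + 1) ≤ 1 := by
          rw [div_le_one (by positivity)]
          linarith [(Nat.cast_nonneg d : (0 : ℝ) ≤ d)]
        nlinarith [norm_nonneg (x i)]
      refine (Finset.sum_le_card_nsmul _ _ _ h1).trans_lt ?_
      rw [Finset.card_univ, Fintype.card_fin, nsmul_eq_mul, mul_one_div, one_pow,
        div_lt_one (by positivity)]
      linarith
    have h2 := sum_length_eq_zero h (d * n) ⟨_, hx1⟩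
    rw [map_zero, ← h2, map_sum]
    refine Finset.sum_congr rfl fun s _ => ?_
    rw [MvPolynomial.eval_monomial, mon_eq_prod_pow, Finsupp.prod_fintype _ _ (by simp)]
    simp [e]
  have h1 := congrArg (MvPolynomial.coeff (Finsupp.equivFunOnFinite.symm fun _ => n)) hP
  rw [MvPolynomial.coeff_zero, MvPolynomial.coeff_sum] at h1
  simp only [MvPolynomial.coeff_monomial, e, EmbeddingLike.apply_eq_iff_eq] at h1
  rw [← Finset.sum_filter] at h1
  rw [← h1]
  refine Finset.sum_congr (Finset.ext fun s => ?_) fun _ _ => rfl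
  simp only [mem_balancedWords, Finset.mem_filter, Set.Finite.mem_toFinset, Set.mem_ofPred_eq,
    funext_iff]
  refine ⟨fun hs => ⟨?_, hs⟩, fun hs => hs.2⟩
  rw [← sum_count_eq_length, Finset.sum_congr rfl fun i _ => hs i]
  simp

theorem inner_wordFeature_eq_zero {v : lp (fun _ : List (Fin d) => ℂ) 2}
    (hv : (fock d).toContinuousLinearMap.adjoint v = 0) (x : Ball d) :
    inner ℂ (wordFeature x) v = 0 := by
  rw [← fock_adjoint_apply, hv, RKHS.coe_zero, Pi.zero_apply]

end WordFeature

/-! ### The weights as word counts, and the factorization of the kernel -/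

section Weight

variable {d : ℕ}

/-- The sum of all words in which every letter occurs `n` times. -/
noncomputable def balancedSum (d n : ℕ) : lp (fun _ : List (Fin d) => ℂ) 2 :=
  ∑ s ∈ balancedWords (Fin d) n, lp.single 2 s 1

theorem inner_balancedSum (v : lp (fun _ : List (Fin d) => ℂ) 2) (n : ℕ) :
    inner ℂ v (balancedSum d n) = conj (∑ s ∈ balancedWords (Fin d) n, v s) := by
  rw [balancedSum, inner_sum, map_sum]
  exact Finset.sum_congr rfl fun s _ => by rw [lp.inner_single_right]; simp

theorem balancedSum_apply {n : ℕ} {s : List (Fin d)} (hs : s ∈ balancedWords (Fin d) n) :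
    balancedSum d n s = 1 := by
  rw [balancedSum, lp.coeFn_sum, Finset.sum_apply]
  simp only [lp.coeFn_single]
  rw [Finset.sum_eq_single s (fun t _ ht => by simp [ht.symm]) (fun h => absurd hs h)]
  simp

theorem fock_adjoint_balancedSum (n : ℕ) (x : Ball d) :
    ((fock d).toContinuousLinearMap.adjoint (balancedSum d n)) x =
      (balancedWords (Fin d) n).card * (∏ i, (x : EuclideanSpace ℂ (Fin d)) i) ^ n := by
  rw [fock_adjoint_apply, inner_balancedSum, map_sum]
  rw [Finset.sum_congr rfl fun s hs => by
    rw [wordFeature_apply, Complex.conj_conj, mon_of_mem_balancedWords _ hs]]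
  simp

/-- This puts the vector in the range of the embedding, so the norm of its image in `H²_d` can be
read off in Fock space. -/
theorem fock_fock_adjoint_balancedSum (n : ℕ) :
    fock d ((fock d).toContinuousLinearMap.adjoint (balancedSum d n)) = balancedSum d n :=
  isometry_adjoint_of_orthogonal _ fun v hv => by
    rw [inner_balancedSum, sum_balancedWords_eq_zero (inner_wordFeature_eq_zero hv), map_zero]

theorem rpow_half_sq (d : ℕ) : ((d : ℝ) ^ ((d : ℝ) / 2)) ^ 2 = (d : ℝ) ^ d := by
  rw [← Real.rpow_natCast, ← Real.rpow_mul (Nat.cast_nonneg d), ← Real.rpow_natCast]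
  norm_num

/-- The adjoint embedding sends `balancedSum d n`, of squared norm `N`, to `N * (∏ i, x i) ^ n`
without changing the norm. Rescaling to `τ ^ n` gives `‖τ ^ n‖ ^ 2 = d ^ (d * n) / N`. -/
theorem weight_eq [NeZero d] (n : ℕ) :
    weight d n = (balancedWords (Fin d) n).card / ((d : ℝ) ^ d) ^ n := by
  have hd : (0 : ℝ) < d := Nat.cast_pos.mpr (Nat.pos_of_ne_zero (NeZero.ne d))
  have hN : (0 : ℝ) < (balancedWords (Fin d) n).card :=
    Nat.cast_pos.mpr (balancedWords_nonempty n).card_pos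
  obtain ⟨N, hNd⟩ : ∃ N : ℝ, N = ((balancedWords (Fin d) n).card : ℕ) := ⟨_, rfl⟩
  rw [← hNd] at hN ⊢
  have h1 : ‖balancedSum d n‖ ^ 2 = N := by
    have h : inner ℂ (balancedSum d n) (balancedSum d n) = (N : ℂ) := by
      have hb : ∑ s ∈ balancedWords (Fin d) n, balancedSum d n s =
          ∑ s ∈ balancedWords (Fin d) n, 1 := Finset.sum_congr rfl fun s hs => balancedSum_apply hs
      rw [inner_balancedSum, hb]
      simp [hNd]
    rw [inner_self_eq_norm_sq_to_K] at h
    exact Complex.ofReal_injective (by simpa using h)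
  have h2 : tauPow d n = ((((d : ℝ) ^ ((d : ℝ) / 2) : ℝ) : ℂ) ^ n / (N : ℂ)) •
      (fock d).toContinuousLinearMap.adjoint (balancedSum d n) := by
    refine RKHS.ext fun x => ?_
    have hN' : (N : ℂ) ≠ 0 := by exact_mod_cast hN.ne'
    have hNc : ((balancedWords (Fin d) n).card : ℂ) = (N : ℂ) := by simp [hNd]
    rw [tauPow_apply, RKHS.coe_smul, Pi.smul_apply, fock_adjoint_balancedSum, tau, mul_pow, hNc,
      smul_eq_mul]
    field_simp
  have h3 : ‖tauPow d n‖ ^ 2 = ((d : ℝ) ^ d) ^ n / N := by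
    rw [h2, norm_smul, ← (fock d).norm_map, fock_fock_adjoint_balancedSum, mul_pow, h1, norm_div,
      norm_pow, Complex.norm_real, Complex.norm_real, div_pow, Real.norm_eq_abs, Real.norm_eq_abs,
      sq_abs, ← pow_mul, mul_comm n 2, pow_mul, sq_abs, rpow_half_sq]
    field_simp
  rw [weight, h3, inv_div]

/-- For each `n`, the words with every letter occurring `n` times contribute equal terms, as many as
`weight_eq` counts; the powers of `d` in `τ` cancel the denominator of the weight. -/
theorem hasSum_mon_balanced [NeZero d] (x y : Ball d) :
    HasSum (fun s : {s : List (Fin d) // Balanced s} =>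
      mon (x : EuclideanSpace ℂ (Fin d)) s * conj (mon (y : EuclideanSpace ℂ (Fin d)) s))
      (hdKernel d (tauMap d x) (tauMap d y)) := by
  have h1 := ((hasSum_mon x y).summable.subtype {s | Balanced s}).hasSum
  have h2 := ((balancedEquiv (Fin d)).hasSum_iff.mpr h1).sigma fun n => hasSum_fintype _
  have h3 := hasSum_hdKernel d (tauMap d x) (tauMap d y)
  have h4 := h3.unique (h2.congr_fun fun n => ?_)
  · rw [h4]
    exact h1
  · have hd : (d : ℂ) ≠ 0 := by exact_mod_cast NeZero.ne d
    have hc : (((d : ℝ) ^ ((d : ℝ) / 2) : ℝ) : ℂ) * (((d : ℝ) ^ ((d : ℝ) / 2) : ℝ) : ℂ)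
        = (d : ℂ) ^ d := by
      rw [← sq]
      exact_mod_cast rpow_half_sq d
    have h5 : (tau d x * conj (tau d y)) = (d : ℂ) ^ d *
        ((∏ i, (x : EuclideanSpace ℂ (Fin d)) i) *
          conj (∏ i, (y : EuclideanSpace ℂ (Fin d)) i)) := by
      rw [tau, tau, map_mul, Complex.conj_ofReal, ← hc]
      ring
    rw [Finset.sum_congr rfl fun s _ => by
      rw [Function.comp_apply, Function.comp_apply, balancedEquiv_apply,
        mon_of_mem_balancedWords _ s.2, mon_of_mem_balancedWords _ s.2]]
    change _ * (tau d x * conj (tau d y)) ^ n = _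
    rw [h5, weight_eq]
    push_cast
    simp only [Finset.sum_const, Finset.card_univ, Fintype.card_coe, nsmul_eq_mul]
    rw [map_pow, mul_pow, mul_pow]
    field_simp

/-- The Drury--Arveson kernel is the product of a positive kernel and the kernel of the weighted
Dirichlet space. -/
theorem hasSum_mon_suffixFree [NeZero d] (x y : Ball d) :
    HasSum (fun u : {u : List (Fin d) // SuffixFree u} =>
      mon (x : EuclideanSpace ℂ (Fin d)) u * conj (mon (y : EuclideanSpace ℂ (Fin d)) u) *
        hdKernel d (tauMap d x) (tauMap d y)) (daKernel d x y) := by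
  have h := (suffixEquiv (Fin d)).hasSum_iff.mpr (hasSum_mon x y)
  refine h.prod_fiberwise fun u => ?_
  refine ((hasSum_mon_balanced x y).mul_left _).congr_fun fun v => ?_
  rw [Function.comp_apply, suffixEquiv_apply, mon_append, mon_append, map_mul]
  ring

/-- For a `d`-th root `q` of `w`, the point with all coordinates `q / √d` has norm `‖q‖ < 1` and is
sent to `w`. -/
theorem tauMap_surjective [NeZero d] : Function.Surjective (tauMap d) := by
  intro w
  have hw : ‖(w : ℂ)‖ < 1 := mem_ball_zero_iff.mp w.2
  have hd : (0 : ℝ) < d := Nat.cast_pos.mpr (Nat.pos_of_ne_zero (NeZero.ne d))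
  obtain ⟨q, hq⟩ := IsAlgClosed.exists_pow_nat_eq (w : ℂ) (Nat.pos_of_ne_zero (NeZero.ne d))
  have hq1 : ‖q‖ < 1 := by
    by_contra! h
    have := one_le_pow₀ h (n := d)
    rw [← norm_pow, hq] at this
    linarith
  let z : EuclideanSpace ℂ (Fin d) := WithLp.toLp 2 fun _ => q / ((√d : ℝ) : ℂ)
  have hz : ‖z‖ ^ 2 = ‖q‖ ^ 2 := by
    rw [EuclideanSpace.norm_sq_eq]
    simp only [z, norm_div, Complex.norm_real, Real.norm_eq_abs, div_pow, sq_abs,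
      Real.sq_sqrt hd.le, Finset.sum_const, Finset.card_univ, Fintype.card_fin, nsmul_eq_mul]
    field_simp
  have hz1 : ‖z‖ < 1 := by nlinarith [norm_nonneg z, norm_nonneg q]
  refine ⟨⟨z, mem_ball_zero_iff.mpr hz1⟩, Subtype.ext ?_⟩
  change tau d z = w
  have hc : (((d : ℝ) ^ ((d : ℝ) / 2) : ℝ) : ℂ) = ((√d : ℝ) : ℂ) ^ d := by
    norm_cast
    rw [Real.sqrt_eq_rpow, ← Real.rpow_natCast, ← Real.rpow_mul hd.le]
    congr 1
    ring
  have hs : ((√d : ℝ) : ℂ) ≠ 0 := by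
    exact_mod_cast (Real.sqrt_pos.mpr hd).ne'
  rw [tau, hc]
  simp only [z, Finset.prod_const, Finset.card_univ, Fintype.card_fin]
  rw [div_pow, mul_div_cancel₀ _ (pow_ne_zero _ hs), hq]

end Weight

/-! ### Amplification of an operator to square summable families -/

section EntrywiseOperator

theorem hasSum_norm_sq {ι E : Type*} [NormedAddCommGroup E] (g : lp (fun _ : ι => E) 2) : HasSum (fun i => ‖g i‖ ^ 2) (‖g‖ ^ 2) := by
  simpa using lp.hasSum_norm (by simp) g

variable {ι E : Type*} [NormedAddCommGroup E] [InnerProductSpace ℂ E]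

/-- A bounded operator applied to each entry of a square summable family. -/
noncomputable def entrywise (T : E →L[ℂ] E) (g : lp (fun _ : ι => E) 2) : lp (fun _ : ι => E) 2 :=
  ⟨fun i => T (g i), by
    refine memℓp_gen ?_
    refine ((hasSum_norm_sq g).summable.mul_left (‖T‖ ^ 2)).of_nonneg_of_le
      (fun i => by positivity) fun i => ?_
    rw [← mul_pow]
    simpa using pow_le_pow_left₀ (norm_nonneg _) (T.le_opNorm (g i)) 2⟩

theorem entrywise_apply (T : E →L[ℂ] E) (g : lp (fun _ : ι => E) 2) (i : ι) :
    entrywise T g i = T (g i) := rfl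

end EntrywiseOperator

/-! ### Composition with `τ` does not increase matrix norms -/

section Composition

variable {d : ℕ} [NeZero d]

/-- Vector valued feature map realizing the factorization of the Drury--Arveson kernel. -/
noncomputable def factorFeature (x : Ball d) :
    lp (fun _ : {u : List (Fin d) // SuffixFree u} => WeightedDirichlet d) 2 :=
  ⟨fun u => conj (mon (x : EuclideanSpace ℂ (Fin d)) u) •
      RKHS.kerFun (WeightedDirichlet d) (tauMap d x) 1, by
    refine memℓp_gen ?_
    refine (((summable_norm_mon_sq x).subtype {u | SuffixFree u}).mul_right
      (‖RKHS.kerFun (WeightedDirichlet d) (tauMap d x) 1‖ ^ 2)).congr fun u => ?_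
    rw [norm_smul, RCLike.norm_conj]
    simp [mul_pow]⟩

theorem inner_kerFun_weightedDirichlet (z w : Disc) :
    inner ℂ (RKHS.kerFun (WeightedDirichlet d) z 1) (RKHS.kerFun (WeightedDirichlet d) w 1)
      = hdKernel d z w := by
  rw [RKHS.kerFun_inner, RKHS.kerFun_apply, kernel_weightedDirichlet, scalarKernel_apply]
  simp

theorem kernel_eq_inner_factorFeature (x y : Ball d) :
    RKHS.kernel (DruryArveson d) x y 1 = inner ℂ (factorFeature x) (factorFeature y) := by
  rw [kernel_druryArveson, scalarKernel_apply, mul_one]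
  refine (hasSum_mon_suffixFree x y).unique ((lp.hasSum_inner (𝕜 := ℂ) _ _).congr_fun fun u => ?_)
  change _ = inner ℂ (_ • _) (_ • _)
  rw [inner_smul_left, inner_smul_right, inner_kerFun_weightedDirichlet, Complex.conj_conj]
  ring

variable (d) in
/-- The isometric embedding of the Drury--Arveson space into a direct sum of copies of the weighted
Dirichlet space. -/
noncomputable def factorEmb : DruryArveson d →ₗᵢ[ℂ]
    lp (fun _ : {u : List (Fin d) // SuffixFree u} => WeightedDirichlet d) 2 :=
  (exists_isometry_of_feature factorFeature kernel_eq_inner_factorFeature).choose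

theorem factorEmb_kerFun (x : Ball d) :
    factorEmb d (RKHS.kerFun (DruryArveson d) x 1) = factorFeature x :=
  (exists_isometry_of_feature factorFeature kernel_eq_inner_factorFeature).choose_spec x

theorem hasSum_factorEmb_adjoint
    (v : lp (fun _ : {u : List (Fin d) // SuffixFree u} => WeightedDirichlet d) 2) (x : Ball d) :
    HasSum (fun u => mon (x : EuclideanSpace ℂ (Fin d)) u.1 * v u (tauMap d x))
      (((factorEmb d).toContinuousLinearMap.adjoint v) x) := by
  rw [adjoint_apply_of_feature factorEmb_kerFun]
  refine (lp.hasSum_inner (𝕜 := ℂ) _ _).congr_fun fun u => ?_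
  change _ = inner ℂ (_ • _) _
  rw [inner_smul_left, RKHS.kerFun_inner, Complex.conj_conj]
  simp

/-- The adjoint evaluates each component at `τ x`, so entrywise multiplication by `φ` comes out as
the common scalar `φ (τ x)`, and what remains is `V* V f = f`. -/
theorem factorEmb_adjoint_entrywise (φ : Mult (WeightedDirichlet d)) (f : DruryArveson d)
    (x : Ball d) :
    ((factorEmb d).toContinuousLinearMap.adjoint (entrywise (mulOp φ) (factorEmb d f))) x =
      (φ : Disc → ℂ) (tauMap d x) * f x := by
  have h := (hasSum_factorEmb_adjoint (factorEmb d f) x).mul_left ((φ : Disc → ℂ) (tauMap d x))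
  rw [adjoint_apply_isometry] at h
  refine (hasSum_factorEmb_adjoint _ x).unique (h.congr_fun fun u => ?_)
  rw [entrywise_apply, mulOp_apply]
  ring

variable (d) in
/-- Composition with `τ` as a map between the multiplier algebras. -/
noncomputable def compTau : Mult (WeightedDirichlet d) →ₗ[ℂ] Mult (DruryArveson d) where
  toFun φ := ⟨fun z => (φ : Disc → ℂ) (tauMap d z), fun f =>
    ⟨_, funext fun x => factorEmb_adjoint_entrywise φ f x⟩⟩
  map_add' _ _ := rfl
  map_smul' _ _ := rfl

theorem compTau_apply (φ : Mult (WeightedDirichlet d)) (z : Ball d) :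
    (compTau d φ : Ball d → ℂ) z = (φ : Disc → ℂ) (tauMap d z) := rfl

theorem mulOp_compTau (φ : Mult (WeightedDirichlet d)) (f : DruryArveson d) :
    mulOp (compTau d φ) f =
      (factorEmb d).toContinuousLinearMap.adjoint (entrywise (mulOp φ) (factorEmb d f)) :=
  RKHS.ext fun x => by rw [mulOp_apply, factorEmb_adjoint_entrywise, compTau_apply]

theorem norm_matOp_compTau_le {r : ℕ} (A : Matrix (Fin r) (Fin r) (Mult (WeightedDirichlet d))) :
    ‖matOp (A.map (compTau d))‖ ≤ ‖matOp A‖ := by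
  refine ContinuousLinearMap.opNorm_le_bound _ (norm_nonneg _) fun f => ?_
  refine le_of_sq_le_sq ?_ (by positivity)
  let g := fun j => factorEmb d (f j)
  let h := fun i => ∑ j, entrywise (mulOp (A i j)) (g j)
  -- Slicing by the suffix-free word `u` instead of the matrix index: the amplified matrix acts on
  -- each slice as `matOp A`, so its bound applies slicewise and sums over `u`.
  let G : _ → PiLp 2 (fun _ : Fin r => WeightedDirichlet d) := fun u => WithLp.toLp 2 fun j => g j u
  have hG : ∀ i u, h i u = matOp A (G u) i := by
    intro i u
    rw [matOp_apply]
    simp only [h, lp.coeFn_sum, Finset.sum_apply]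
    rfl
  have h1 : ‖matOp (A.map (compTau d)) f‖ ^ 2 ≤ ∑ i, ‖h i‖ ^ 2 := by
    rw [PiLp.norm_sq_eq_of_L2]
    refine Finset.sum_le_sum fun i _ => pow_le_pow_left₀ (norm_nonneg _) ?_ 2
    rw [matOp_apply]
    simp only [Matrix.map_apply, mulOp_compTau, ← map_sum]
    exact norm_adjoint_isometry_le _ _
  have h2 : HasSum (fun u => ‖matOp A (G u)‖ ^ 2) (∑ i, ‖h i‖ ^ 2) := by
    refine (hasSum_sum fun i _ => hasSum_norm_sq (h i)).congr_fun fun u => ?_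
    rw [PiLp.norm_sq_eq_of_L2]
    exact Finset.sum_congr rfl fun i _ => by rw [hG]
  have h3 : HasSum (fun u => ‖matOp A‖ ^ 2 * ‖G u‖ ^ 2) (‖matOp A‖ ^ 2 * ∑ j, ‖g j‖ ^ 2) := by
    refine ((hasSum_sum fun j _ => hasSum_norm_sq (g j)).congr_fun fun u => ?_).mul_left _
    rw [PiLp.norm_sq_eq_of_L2]
  have h4 : ∑ j, ‖g j‖ ^ 2 = ‖f‖ ^ 2 := by
    rw [PiLp.norm_sq_eq_of_L2]
    exact Finset.sum_congr rfl fun j _ => by rw [(factorEmb d).norm_map]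
  refine h1.trans ?_
  rw [mul_pow, ← h4]
  refine hasSum_le (fun u => ?_) h2 h3
  rw [← mul_pow]
  exact pow_le_pow_left₀ (norm_nonneg _) ((matOp A).le_opNorm _) 2

end Composition

/-! ### Composition with `τ` does not decrease matrix norms -/

section Embedding

variable {d : ℕ}

/-- The part of `wordFeature` supported on the balanced words. -/
noncomputable def balancedFeature (x : Ball d) : lp (fun _ : List (Fin d) => ℂ) 2 :=
  ⟨Set.indicator {s | Balanced s} (wordFeature x), by
    refine memℓp_gen ?_
    refine ((hasSum_norm_sq (wordFeature x)).summable.indicator {s | Balanced s}).congr fun s => ?_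
    by_cases hs : s ∈ {s : List (Fin d) | Balanced s} <;> simp [hs]⟩

theorem hasSum_inner_balancedFeature (v : lp (fun _ : List (Fin d) => ℂ) 2) (x : Ball d) :
    HasSum (fun s : {s : List (Fin d) // Balanced s} =>
      conj (v s) * conj (mon (x : EuclideanSpace ℂ (Fin d)) s))
      (inner ℂ v (balancedFeature x)) := by
  have h := hasSum_subtype_iff_indicator (s := {s : List (Fin d) | Balanced s})
    (a := inner ℂ v (balancedFeature x)) (f := fun s => conj (v s) * conj (mon (x : EuclideanSpace ℂ (Fin d)) s))
  refine h.mpr ((lp.hasSum_inner (𝕜 := ℂ) v (balancedFeature x)).congr_fun fun s => ?_)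
  change _ = inner ℂ (v s) (Set.indicator {s | Balanced s} (wordFeature x) s)
  by_cases hs : s ∈ {s : List (Fin d) | Balanced s}
  · rw [Set.indicator_of_mem hs, Set.indicator_of_mem hs, wordFeature_apply, RCLike.inner_apply]
    ring
  · rw [Set.indicator_of_notMem hs, Set.indicator_of_notMem hs, inner_zero_right]

variable [NeZero d]

theorem inner_wordFeature_balancedFeature (x y : Ball d) :
    inner ℂ (wordFeature x) (balancedFeature y) = hdKernel d (tauMap d x) (tauMap d y) := by
  refine (hasSum_inner_balancedFeature _ y).unique ((hasSum_mon_balanced x y).congr_fun fun s => ?_)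
  rw [wordFeature_apply, Complex.conj_conj]

theorem inner_balancedFeature (x y : Ball d) :
    inner ℂ (balancedFeature x) (balancedFeature y) = hdKernel d (tauMap d x) (tauMap d y) := by
  refine (hasSum_inner_balancedFeature _ y).unique ((hasSum_mon_balanced x y).congr_fun fun s => ?_)
  change conj (Set.indicator {s | Balanced s} (wordFeature x) s) * _ = _
  rw [Set.indicator_of_mem (show s.1 ∈ {s | Balanced s} from s.2), wordFeature_apply,
    Complex.conj_conj]

/-- The coefficients of this vector depend only on the common letter count `n`. Pairing it with an
element of the kernel of the adjoint therefore gives a series in `n` whose terms vanish by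
`sum_balancedWords_eq_zero`. -/
theorem fock_fock_adjoint_balancedFeature (x : Ball d) :
    fock d ((fock d).toContinuousLinearMap.adjoint (balancedFeature x)) = balancedFeature x := by
  refine isometry_adjoint_of_orthogonal _ fun v hv => ?_
  have h := ((balancedEquiv (Fin d)).hasSum_iff.mpr (hasSum_inner_balancedFeature v x)).sigma
    fun n => hasSum_fintype _
  refine h.unique (hasSum_zero.congr_fun fun n => ?_)
  rw [Finset.sum_congr rfl fun s _ => by
    rw [Function.comp_apply, balancedEquiv_apply, mon_of_mem_balancedWords _ s.2]]
  rw [← Finset.sum_mul, ← map_sum,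
    Finset.sum_coe_sort (balancedWords (Fin d) n) fun s => v s,
    sum_balancedWords_eq_zero (inner_wordFeature_eq_zero hv), map_zero, zero_mul]

/-- Kernel functions of the weighted Dirichlet space, composed with `τ`. -/
noncomputable def discFeature (w : Disc) : DruryArveson d :=
  (fock d).toContinuousLinearMap.adjoint
    (balancedFeature (Function.surjInv (tauMap_surjective (d := d)) w))

/-- The chosen preimage of `w` under `τ` enters only through its image, so the choice is immaterial.
-/
theorem discFeature_apply (w : Disc) (x : Ball d) :
    discFeature w x = hdKernel d (tauMap d x) w := by
  rw [discFeature, fock_adjoint_apply, inner_wordFeature_balancedFeature, Function.surjInv_eq tauMap_surjective]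

theorem kernel_eq_inner_discFeature (z w : Disc) :
    RKHS.kernel (WeightedDirichlet d) z w 1 =
      inner ℂ (discFeature z : DruryArveson d) (discFeature w) := by
  rw [kernel_weightedDirichlet, scalarKernel_apply, mul_one, discFeature, discFeature,
    inner_adjoint_of_isometry_adjoint _ _ (fock_fock_adjoint_balancedFeature _),
    inner_balancedFeature, Function.surjInv_eq tauMap_surjective, Function.surjInv_eq tauMap_surjective]

variable (d) in
/-- Composition with `τ` is an isometric embedding of the weighted Dirichlet space into the
Drury--Arveson space. -/
theorem exists_isometry_comp_tau : ∃ J : WeightedDirichlet d →ₗᵢ[ℂ] DruryArveson d,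
    ∀ f x, J f x = f (tauMap d x) := by
  obtain ⟨J, hJ⟩ := exists_isometry_of_feature (discFeature (d := d)) kernel_eq_inner_discFeature
  refine ⟨J, fun f x => ?_⟩
  -- An isometry with `J K_w = K(τ ·, w)` satisfies `J* k_x = K_{τ x}`, by Hermitian symmetry of
  -- `K`. Pairing this with `f` shows that `J` is composition with `τ`.
  have h1 : J.toContinuousLinearMap.adjoint (RKHS.kerFun (DruryArveson d) x 1) =
      RKHS.kerFun (WeightedDirichlet d) (tauMap d x) 1 := by
    refine RKHS.ext fun w => ?_
    rw [adjoint_apply_of_feature hJ, RKHS.inner_kerFun, discFeature_apply, RKHS.kerFun_apply,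
      kernel_weightedDirichlet, scalarKernel_apply, hdKernel_eq, hdKernel_eq,
      ← inner_conj_symm (hdFeature d w)]
    simp
  have h2 := ContinuousLinearMap.adjoint_inner_left J.toContinuousLinearMap f
    (RKHS.kerFun (DruryArveson d) x 1)
  rw [h1, RKHS.kerFun_inner, RKHS.kerFun_inner] at h2
  simpa using h2.symm

theorem norm_matOp_le_compTau {r : ℕ} (A : Matrix (Fin r) (Fin r) (Mult (WeightedDirichlet d))) :
    ‖matOp A‖ ≤ ‖matOp (A.map (compTau d))‖ := by
  obtain ⟨J, hJ⟩ := exists_isometry_comp_tau d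
  refine ContinuousLinearMap.opNorm_le_bound _ (norm_nonneg _) fun f => ?_
  let g : PiLp 2 (fun _ : Fin r => DruryArveson d) := WithLp.toLp 2 fun j => J (f j)
  have hmul : ∀ (φ : Mult (WeightedDirichlet d)) (f : WeightedDirichlet d),
      mulOp (compTau d φ) (J f) = J (mulOp φ f) := fun φ f =>
    RKHS.ext fun x => by rw [mulOp_apply, hJ, hJ, mulOp_apply, compTau_apply]
  have h1 : ‖g‖ = ‖f‖ := by
    rw [PiLp.norm_eq_of_L2, PiLp.norm_eq_of_L2]
    simp only [g, J.norm_map]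
  have h2 : ‖matOp (A.map (compTau d)) g‖ = ‖matOp A f‖ := by
    rw [PiLp.norm_eq_of_L2, PiLp.norm_eq_of_L2]
    simp only [matOp_apply, Matrix.map_apply, g, hmul, ← map_sum, J.norm_map]
  rw [← h1, ← h2]
  exact ContinuousLinearMap.le_opNorm _ _

end Embedding
end MultEmbed

theorem mainTheorem5 (d : ℕ) [NeZero d] :
    ∃ Φ : MultEmbed.Mult (MultEmbed.WeightedDirichlet d) →ₗ[ℂ]
        MultEmbed.Mult (MultEmbed.DruryArveson d),
      (∀ (φ : MultEmbed.Mult (MultEmbed.WeightedDirichlet d)) (z : MultEmbed.Ball d),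
        (Φ φ : MultEmbed.Ball d → ℂ) z =
          (φ : MultEmbed.Disc → ℂ) (MultEmbed.tauMap d z)) ∧
      Φ 1 = 1 ∧
      MultEmbed.IsCompleteIsometry Φ :=
  ⟨MultEmbed.compTau d, MultEmbed.compTau_apply, rfl, fun _ A =>
    le_antisymm (MultEmbed.norm_matOp_compTau_le A) (MultEmbed.norm_matOp_le_compTau A)⟩
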